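/- Let $\mathbb{K}$ be $\mathbb{R}$ or $\mathbb{C}$. For a Banach space $X$ over $\mathbb{K}$ with dual $X^*$ put $\Pi(X)=\{(x,x^*)\in X\times X^*\colon \|x\|=\|x^*\|=x^*(x)=1\}$, and for a bounded linear operator $T\colon X\to X$ let $\nu(T)=\sup\{|x^*(Tx)|\colon (x,x^*)\in\Pi(X)\}$ be its numerical radius (with $\sup\emptyset=0$). Given a function $\eta\colon(0,1)\to(0,1)$, say that $X$ has the *Bishop-Phelps-Bollobás property for numerical radius for compact operators* (BPBp-nu for compact operators) *with the function $\eta$* if, for every $\varepsilon\in(0,1)$, whenever $T\colon X\to X$ is a compact linear operator and $(x,x^*)\in\Pi(X)$ satisfy $\nu(T)=1$ and $|x^*(Tx)|>1-\eta(\varepsilon)$, there exist a compact linear operator $S\colon X\to X$ and $(y,y^*)\in\Pi(X)$ such that $$\nu(S)=|y^*(Sy)|=1,\quad \|T-S\|<\varepsilon,\quad \|x-y\|<\varepsilon,\quad \|x^*-y^*\|<\varepsilon.$$ **Corollary 2.4.** There is a function $\eta\colon(0,1)\to(0,1)$ such that the space $c_0$ of null sequences in $\mathbb{K}$ and all the spaces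 $\ell_\infty^n=(\mathbb{K}^n,\|\cdot\|_\infty)$, $n\in\mathbb{N}$, have the BPBp-nu for compact operators with this same function $\eta$. -/

import Mathlib

open scoped ZeroAtInfty

noncomputable section

namespace BPB

/-- The set `Π(X)` of pairs `(x, x*)` in `S_X × S_{X*}` with `x*(x) = 1`. -/
def statePairs (𝕜 : Type*) [RCLike 𝕜] (X : Type*) [NormedAddCommGroup X] [NormedSpace 𝕜 X] :
    Set (X × StrongDual 𝕜 X) :=
  {p | ‖p.1‖ = 1 ∧ ‖p.2‖ = 1 ∧ p.2 p.1 = 1}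

/-- The numerical radius `ν(T) = sup {|x*(T x)| : (x, x*) ∈ Π(X)}`. The set is bounded above by
`‖T‖`; it is empty only for `X = {0}`, where the value is `0`. -/
def numericalRadius {𝕜 : Type*} [RCLike 𝕜] {X : Type*} [NormedAddCommGroup X] [NormedSpace 𝕜 X]
    (T : X →L[𝕜] X) : ℝ :=
  sSup {r : ℝ | ∃ p ∈ statePairs 𝕜 X, r = ‖p.2 (T p.1)‖}

/-- `X` has the Bishop-Phelps-Bollobás property for numerical radius for compact operators
with the function `η : (0,1) → (0,1)`. -/
def HasBPBpNuCompactWith (𝕜 : Type*) [RCLike 𝕜] (X : Type*) [NormedAddCommGroup X]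
    [NormedSpace 𝕜 X] (η : Set.Ioo (0 : ℝ) 1 → Set.Ioo (0 : ℝ) 1) : Prop :=
  ∀ (ε : Set.Ioo (0 : ℝ) 1) (T : X →L[𝕜] X) (x : X) (x' : StrongDual 𝕜 X),
    IsCompactOperator T → (x, x') ∈ statePairs 𝕜 X → numericalRadius T = 1 →
    1 - (η ε : ℝ) < ‖x' (T x)‖ →
    ∃ (S : X →L[𝕜] X) (y : X) (y' : StrongDual 𝕜 X),
      IsCompactOperator S ∧ (y, y') ∈ statePairs 𝕜 X ∧
      numericalRadius S = 1 ∧ ‖y' (S y)‖ = 1 ∧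
      ‖T - S‖ < (ε : ℝ) ∧ ‖x - y‖ < (ε : ℝ) ∧ ‖x' - y'‖ < (ε : ℝ)

end BPB

end

/-!
The proof treats `c₀` and all `ℓ_∞^n` at once, as normed spaces with null coordinates, and
perturbs a given operator coordinate by coordinate.

Let `‖T‖ = ν(T) = 1` (these spaces have numerical index one, `norm_le_numericalRadius`) and let the
state pair `(x, x')` satisfy `1 - c ^ 6 < ‖x' (T x)‖`. The functional `x'` is a convex combination of
coordinate functionals, rotated by the conjugates of the coordinates of `x` (which have absolute
value one on the support of `x'`). Hence `x' (T x)` is an average, and all but a mass of `c ^ 2` of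
`x'` sits on a set `A` of indices `i` for which the `i`-th row of `T` comes within `c ^ 4` of
attaining its norm at `x`, with the argument that the average prescribes (`exists_finset_mass`).
The set `A` is finite because `T x` is a null family. The functional `y'` is the normalized
restriction of `x'` to `A`.

The vector `y` arises from `x` by pushing to the unit sphere those coordinates whose absolute
value is at least `1 - c ^ 2` (`exists_near_unimodular`). A row in `A` has nearly all of its
`ℓ₁`-mass on these coordinates, with nearly the right phases; correcting the phases and normalizing
moves it by at most `4 * c` and makes it attain its norm at `y` (`exists_near_functional`). Since
`y` does not depend on the row, all rows in `A` can be replaced simultaneously. The result `S` is a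
finite rank perturbation of `T`, hence compact, and `y' (S y)` has absolute value one.

All estimates rest on `norm_sub_sum_le`, a finite form of the identification of the dual with `ℓ₁`.
They do not involve the index set, so that `η ε = (ε / 8) ^ 6` serves all the spaces.
-/

namespace BPB

open Filter Topology

/-! ### Null coordinates -/

/-- Coordinates identifying a normed space `X` with a space of null families indexed by `ι` under
the supremum norm: unit vectors `vec i` with biorthogonal functionals `coord i`, such that the norm
is the supremum of the absolute values of the coordinates and every element has only finitely many
coordinates above any positive level. Both `c₀` and `ℓ_∞^n` carry such coordinates. -/
structure NullCoordinates (𝕜 : Type*) [RCLike 𝕜] (X : Type*) [NormedAddCommGroup X]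
    [NormedSpace 𝕜 X] (ι : Type*) where
  /-- the unit vectors -/
  vec : ι → X
  /-- the coordinate functionals -/
  coord : ι → StrongDual 𝕜 X
  coord_vec_self (i : ι) : coord i (vec i) = 1
  coord_vec_of_ne {i j : ι} : j ≠ i → coord j (vec i) = 0
  norm_coord_le (i : ι) (x : X) : ‖coord i x‖ ≤ ‖x‖
  norm_le {x : X} {r : ℝ} : 0 ≤ r → (∀ i, ‖coord i x‖ ≤ r) → ‖x‖ ≤ r
  finite_le (x : X) {r : ℝ} : 0 < r → {i | r ≤ ‖coord i x‖}.Finite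

variable {𝕜 : Type*} [RCLike 𝕜] {X : Type*} [NormedAddCommGroup X] [NormedSpace 𝕜 X]

/-! ### The `ℓ₁`-structure of the dual -/

namespace NullCoordinates

variable {ι : Type*} (e : NullCoordinates 𝕜 X ι)
include e

lemma coord_sum_smul_vec_of_mem {B : Finset ι} (c : ι → 𝕜) {i : ι} (hi : i ∈ B) :
    e.coord i (∑ j ∈ B, c j • e.vec j) = c i := by
  rw [map_sum, Finset.sum_eq_single_of_mem i hi]
  · simp [e.coord_vec_self]
  · intro j _ hj
    simp [e.coord_vec_of_ne hj.symm]

lemma coord_sum_smul_vec_of_notMem {B : Finset ι} (c : ι → 𝕜) {i : ι} (hi : i ∉ B) :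
    e.coord i (∑ j ∈ B, c j • e.vec j) = 0 := by
  rw [map_sum]
  refine Finset.sum_eq_zero fun j hj => ?_
  have : i ≠ j := fun h => hi (h ▸ hj)
  simp [e.coord_vec_of_ne this]

/-- The coordinates of `φ` in a finite set `B` use up `∑ j ∈ B, ‖φ (e.vec j)‖` of the norm of `φ`;
only the rest acts on the coordinates off `B`. -/
lemma norm_sub_sum_le (φ : StrongDual 𝕜 X) (B : Finset ι) {r : ℝ} (hr : 0 ≤ r)
    (z : X) (hz : ∀ j ∉ B, ‖e.coord j z‖ ≤ r) :
    ‖φ z - ∑ j ∈ B, e.coord j z * φ (e.vec j)‖ ≤ r * (‖φ‖ - ∑ j ∈ B, ‖φ (e.vec j)‖) := by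
  choose c hc hcφ using fun j => RCLike.exists_norm_eq_mul_self (φ (e.vec j))
  set w : X := z - ∑ j ∈ B, e.coord j z • e.vec j with hw
  have hφw : φ w = φ z - ∑ j ∈ B, e.coord j z * φ (e.vec j) := by simp [hw]
  obtain ⟨σ, hσ, hσφ⟩ := RCLike.exists_norm_eq_mul_self (φ w)
  -- On `B` this vector has the phases that make `φ` largest, off `B` it is a rotation of `z`.
  set v : X := (∑ j ∈ B, ((r : 𝕜) * c j) • e.vec j) + σ • w with hv
  have hvn : ‖v‖ ≤ r := by
    refine e.norm_le hr fun i => ?_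
    by_cases hi : i ∈ B
    · have : e.coord i v = r * c i := by
        rw [hv, hw, map_add, map_smul, map_sub, e.coord_sum_smul_vec_of_mem _ hi,
          e.coord_sum_smul_vec_of_mem _ hi]
        simp
      simp [this, hc, abs_of_nonneg hr]
    · have : e.coord i v = σ * e.coord i z := by
        rw [hv, hw, map_add, map_smul, map_sub, e.coord_sum_smul_vec_of_notMem _ hi,
          e.coord_sum_smul_vec_of_notMem _ hi]
        simp
      simpa [this, hσ] using hz i hi
  have hφv : φ v = ((r * ∑ j ∈ B, ‖φ (e.vec j)‖ + ‖φ w‖ : ℝ) : 𝕜) := by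
    rw [RCLike.ofReal_add, RCLike.ofReal_mul, RCLike.ofReal_sum, hσφ, Finset.mul_sum]
    simp [hv, mul_assoc, hcφ]
  have h1 : r * ∑ j ∈ B, ‖φ (e.vec j)‖ + ‖φ w‖ ≤ ‖φ v‖ := by
    rw [hφv, RCLike.norm_ofReal]
    exact le_abs_self _
  have h2 : ‖φ v‖ ≤ ‖φ‖ * r := (φ.le_opNorm v).trans (by gcongr)
  rw [← hφw]
  linarith

lemma sum_norm_apply_vec_le (φ : StrongDual 𝕜 X) (B : Finset ι) :
    ∑ j ∈ B, ‖φ (e.vec j)‖ ≤ ‖φ‖ := by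
  simpa using e.norm_sub_sum_le φ B zero_le_one 0 (by simp)

lemma norm_sum_smul_coord_le (B : Finset ι) (b : ι → 𝕜) :
    ‖∑ j ∈ B, b j • e.coord j‖ ≤ ∑ j ∈ B, ‖b j‖ := by
  refine (norm_sum_le _ _).trans (Finset.sum_le_sum fun j _ => ?_)
  rw [norm_smul]
  refine mul_le_of_le_one_right (norm_nonneg _) ?_
  exact ContinuousLinearMap.opNorm_le_bound _ zero_le_one
    fun x => by simpa using e.norm_coord_le j x

/-- The distance from `φ` to a finitely supported functional, in terms of coordinates. -/
lemma norm_sub_sum_coord_le (φ : StrongDual 𝕜 X) (B : Finset ι) (b : ι → 𝕜) :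
    ‖φ - ∑ j ∈ B, b j • e.coord j‖ ≤
      (‖φ‖ - ∑ j ∈ B, ‖φ (e.vec j)‖) + ∑ j ∈ B, ‖φ (e.vec j) - b j‖ := by
  have h1 : ‖φ - ∑ j ∈ B, φ (e.vec j) • e.coord j‖ ≤
      ‖φ‖ - ∑ j ∈ B, ‖φ (e.vec j)‖ := by
    refine ContinuousLinearMap.opNorm_le_bound _
      (sub_nonneg.2 (e.sum_norm_apply_vec_le φ B)) fun z => ?_
    have h := e.norm_sub_sum_le φ B (norm_nonneg z) z fun j _ => e.norm_coord_le j z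
    simpa [mul_comm] using h
  have h2 := e.norm_sum_smul_coord_le B fun j => φ (e.vec j) - b j
  have h3 : φ - ∑ j ∈ B, b j • e.coord j = (φ - ∑ j ∈ B, φ (e.vec j) • e.coord j) +
      ∑ j ∈ B, (φ (e.vec j) - b j) • e.coord j := by
    ext z
    simp [sub_mul]
  rw [h3]
  exact (norm_add_le _ _).trans (add_le_add h1 h2)

end NullCoordinates

/-! ### The numerical radius -/

lemma norm_apply_le_norm_of_mem_statePairs (T : X →L[𝕜] X) {p : X × StrongDual 𝕜 X}
    (hp : p ∈ statePairs 𝕜 X) : ‖p.2 (T p.1)‖ ≤ ‖T‖ := by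
  obtain ⟨h1, h2, -⟩ := hp
  have := (p.2.le_opNorm (T p.1)).trans
    (mul_le_mul_of_nonneg_left (T.le_opNorm p.1) (norm_nonneg _))
  simpa [h1, h2] using this

lemma norm_apply_le_numericalRadius (T : X →L[𝕜] X) {p : X × StrongDual 𝕜 X}
    (hp : p ∈ statePairs 𝕜 X) : ‖p.2 (T p.1)‖ ≤ numericalRadius T := by
  refine le_csSup ⟨‖T‖, ?_⟩ ⟨p, hp, rfl⟩
  rintro _ ⟨q, hq, rfl⟩
  exact norm_apply_le_norm_of_mem_statePairs T hq

lemma numericalRadius_le_norm (T : X →L[𝕜] X) : numericalRadius T ≤ ‖T‖ := by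
  refine Real.sSup_le ?_ (norm_nonneg _)
  rintro _ ⟨q, hq, rfl⟩
  exact norm_apply_le_norm_of_mem_statePairs T hq

lemma star_mul_self_of_norm_eq_one {c : 𝕜} (hc : ‖c‖ = 1) : star c * c = 1 := by
  have := RCLike.conj_mul c
  simpa [hc] using this

/-- A norm-one vector and a functional of norm at most one that takes the value one on it form a
state pair. -/
lemma mem_statePairs {x : X} {φ : StrongDual 𝕜 X} (hx : ‖x‖ = 1) (hφ : ‖φ‖ ≤ 1)
    (h : φ x = 1) : (x, φ) ∈ statePairs 𝕜 X := by
  refine ⟨hx, le_antisymm hφ ?_, h⟩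
  have := φ.le_opNorm x
  rw [h, hx] at this
  simpa using this

namespace NullCoordinates

variable {ι : Type*} (e : NullCoordinates 𝕜 X ι)
include e

/-- Spaces with null coordinates have numerical index one: the norm of an operator is at most its
numerical radius. -/
lemma norm_le_numericalRadius (T : X →L[𝕜] X) : ‖T‖ ≤ numericalRadius T := by
  have h0 : 0 ≤ numericalRadius T :=
    Real.sSup_nonneg (by rintro _ ⟨q, -, rfl⟩; exact norm_nonneg _)
  have key (x : X) (hx : ‖x‖ ≤ 1) (i : ι) : ‖e.coord i (T x)‖ ≤ numericalRadius T := by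
    -- Move the `i`-th coordinate of `x` to the unit sphere and rotate the others, so that the
    -- two contributions to the `i`-th coordinate of `T x` have the same argument.
    obtain ⟨τ, hτ, hτT⟩ := RCLike.exists_norm_eq_mul_self (e.coord i (T (e.vec i)))
    set w : X := x - e.coord i x • e.vec i with hw
    obtain ⟨σ, hσ, hσT⟩ := RCLike.exists_norm_eq_mul_self (e.coord i (T w))
    set z : X := τ • e.vec i + σ • w with hz
    have hzi : e.coord i z = τ := by simp [hz, hw, e.coord_vec_self]
    have hzn : ‖z‖ = 1 := by
      refine le_antisymm (e.norm_le zero_le_one fun j => ?_) ?_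
      · by_cases hj : j = i
        · subst hj
          rw [hzi, hτ]
        · have : e.coord j z = σ * e.coord j x := by simp [hz, hw, e.coord_vec_of_ne hj]
          rw [this, norm_mul, hσ, one_mul]
          exact (e.norm_coord_le j x).trans hx
      · rw [← hτ, ← hzi]
        exact e.norm_coord_le i z
    have hpair : (z, star τ • e.coord i) ∈ statePairs 𝕜 X := by
      refine mem_statePairs hzn ?_ (by simpa [hzi] using star_mul_self_of_norm_eq_one hτ)
      simpa [hτ] using e.norm_sum_smul_coord_le {i} fun _ => star τ
    have h1 := norm_apply_le_numericalRadius T hpair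
    have h2 : e.coord i (T z) = ((‖e.coord i (T (e.vec i))‖ + ‖e.coord i (T w)‖ : ℝ) : 𝕜) := by
      rw [RCLike.ofReal_add, hτT, hσT]
      simp [hz]
    have h3 : T x = e.coord i x • T (e.vec i) + T w := by
      simp [hw]
    have h4 : ‖e.coord i (T x)‖ ≤ ‖e.coord i (T (e.vec i))‖ + ‖e.coord i (T w)‖ := by
      rw [h3, map_add, map_smul, smul_eq_mul]
      refine (norm_add_le _ _).trans (add_le_add ?_ le_rfl)
      rw [norm_mul]
      exact mul_le_of_le_one_left (norm_nonneg _) ((e.norm_coord_le i x).trans hx)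
    have h5 : ‖(star τ • e.coord i) (T z)‖ =
        ‖e.coord i (T (e.vec i))‖ + ‖e.coord i (T w)‖ := by
      rw [smul_apply, norm_smul, norm_star, hτ, one_mul, h2,
        RCLike.norm_ofReal, abs_of_nonneg (by positivity)]
    exact h4.trans (h5 ▸ h1)
  let : NormedSpace ℝ X := NormedSpace.restrictScalars ℝ 𝕜 X
  refine ContinuousLinearMap.opNorm_le_of_unit_norm h0 fun x hx => ?_
  exact e.norm_le h0 (key x hx.le)

end NullCoordinates

/-! ### Approximation of functionals and operators -/

/-- A linear bound for the distance from `u` to its absolute value. The exact value is the square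
root of `2 * ‖u‖ * (‖u‖ - re u)`; the arithmetic-geometric mean inequality turns it into a bound that can be summed. -/
lemma norm_sub_norm_le (u : 𝕜) {c : ℝ} (hc : 0 < c) :
    ‖u - (‖u‖ : 𝕜)‖ ≤ c * ‖u‖ + (‖u‖ - RCLike.re u) / (2 * c) := by
  have hre : RCLike.re u ≤ ‖u‖ := RCLike.re_le_norm u
  have h1 : ‖u - (‖u‖ : 𝕜)‖ ^ 2 = 2 * ‖u‖ * (‖u‖ - RCLike.re u) := by
    have h := RCLike.norm_sq_eq_def (z := u)
    rw [RCLike.norm_sq_eq_def]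
    simp only [map_sub, RCLike.ofReal_re, RCLike.ofReal_im]
    nlinarith
  have h2 : 0 ≤ (‖u‖ - RCLike.re u) / (2 * c) := div_nonneg (by linarith) (by linarith)
  refine abs_le_of_sq_le_sq' ?_ (by positivity) |>.2
  have h3 : c * ‖u‖ * ((‖u‖ - RCLike.re u) / (2 * c)) = ‖u‖ * (‖u‖ - RCLike.re u) / 2 := by
    field_simp
  rw [h1]
  nlinarith [sq_nonneg (c * ‖u‖ - (‖u‖ - RCLike.re u) / (2 * c))]

namespace NullCoordinates

variable {ι : Type*} (e : NullCoordinates 𝕜 X ι)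
include e

/-- A vector of the unit ball is close to one whose coordinates have absolute value one wherever
the original ones nearly do. -/
lemma exists_near_unimodular {x : X} (hx : ‖x‖ ≤ 1) {d : ℝ} (hd : 0 < d) (hd1 : d < 1) :
    ∃ (B : Finset ι) (y : X), ‖y‖ ≤ 1 ∧ ‖x - y‖ ≤ d ∧ (∀ j ∉ B, ‖e.coord j x‖ ≤ 1 - d) ∧
      ∀ j ∈ B, 1 - d ≤ ‖e.coord j x‖ ∧ ‖e.coord j y‖ = 1 ∧
        e.coord j x = ‖e.coord j x‖ * e.coord j y := by
  have hfin := e.finite_le x (r := 1 - d) (by linarith)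
  set B := hfin.toFinset with hB
  have hmem (j : ι) : j ∈ B ↔ 1 - d ≤ ‖e.coord j x‖ := by simp [hB]
  set y : X := x + ∑ j ∈ B, (e.coord j x / ‖e.coord j x‖ - e.coord j x) • e.vec j with hy
  have hyB {j : ι} (hj : j ∈ B) : e.coord j y = e.coord j x / ‖e.coord j x‖ := by
    rw [hy, map_add, e.coord_sum_smul_vec_of_mem _ hj]
    ring
  have hyN {j : ι} (hj : j ∉ B) : e.coord j y = e.coord j x := by
    rw [hy, map_add, e.coord_sum_smul_vec_of_notMem _ hj, add_zero]
  have hpos {j : ι} (hj : j ∈ B) : 0 < ‖e.coord j x‖ := by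
    have := (hmem j).1 hj
    linarith
  have hx1 (j : ι) : ‖e.coord j x‖ ≤ 1 := (e.norm_coord_le j x).trans hx
  have hyn {j : ι} (hj : j ∈ B) : ‖e.coord j y‖ = 1 := by
    rw [hyB hj, norm_div, RCLike.norm_ofReal, abs_norm, div_self (hpos hj).ne']
  have hxy {j : ι} (hj : j ∈ B) : e.coord j x = ‖e.coord j x‖ * e.coord j y := by
    have : (‖e.coord j x‖ : 𝕜) ≠ 0 := RCLike.ofReal_ne_zero.2 (hpos hj).ne'
    rw [hyB hj]
    field_simp
  refine ⟨B, y, e.norm_le zero_le_one fun j => ?_, e.norm_le hd.le fun j => ?_, fun j hj => ?_,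
    fun j hj => ⟨(hmem j).1 hj, hyn hj, hxy hj⟩⟩
  · by_cases hj : j ∈ B
    · exact (hyn hj).le
    · rw [hyN hj]
      exact hx1 j
  · rw [map_sub]
    by_cases hj : j ∈ B
    · have h1 : e.coord j x - e.coord j y = ((‖e.coord j x‖ - 1 : ℝ) : 𝕜) * e.coord j y := by
        rw [RCLike.ofReal_sub, sub_mul, ← hxy hj, RCLike.ofReal_one, one_mul]
      rw [h1, norm_mul, hyn hj, mul_one, RCLike.norm_ofReal, abs_le]
      have := (hmem j).1 hj
      exact ⟨by linarith, by linarith [hx1 j]⟩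
    · rw [hyN hj, sub_self, norm_zero]
      exact hd.le
  · exact (lt_of_not_ge fun h => hj ((hmem j).2 h)).le

/-- A functional that nearly attains its norm at `x` is close to one that attains it at `y`, where
`y` depends only on `x` and not on the functional. -/
lemma exists_near_functional {x y : X} {B : Finset ι} {c : ℝ} (hc : 0 < c) (hc1 : c < 1)
    (hx : ‖x‖ ≤ 1) (hxN : ∀ j ∉ B, ‖e.coord j x‖ ≤ 1 - c ^ 2)
    (hxB : ∀ j ∈ B, 1 - c ^ 2 ≤ ‖e.coord j x‖ ∧ ‖e.coord j y‖ = 1 ∧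
      e.coord j x = ‖e.coord j x‖ * e.coord j y)
    {φ : StrongDual 𝕜 X} (hφ : ‖φ‖ ≤ 1) (hφx : 1 - c ^ 4 < RCLike.re (φ x)) :
    ∃ ψ : StrongDual 𝕜 X, ‖ψ‖ ≤ 1 ∧ ψ y = 1 ∧ ‖φ - ψ‖ ≤ 4 * c := by
  have hc2 : c ^ 2 < 1 := by nlinarith
  have hc2' : 0 < c ^ 2 := by positivity
  set a : ι → 𝕜 := fun j => φ (e.vec j) with ha
  set u : ι → 𝕜 := fun j => e.coord j y * a j with hu
  set r : ℝ := ∑ j ∈ B, ‖a j‖ with hr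
  have hr1 : r ≤ 1 := (e.sum_norm_apply_vec_le φ B).trans hφ
  have hun {j : ι} (hj : j ∈ B) : ‖u j‖ = ‖a j‖ := by
    rw [hu]
    simp [(hxB j hj).2.1]
  have hure (j : ι) : RCLike.re (u j) ≤ ‖u j‖ := RCLike.re_le_norm _
  have hure' (j : ι) : -‖u j‖ ≤ RCLike.re (u j) := (abs_le.1 (RCLike.abs_re_le_norm _)).1
  have hre {j : ι} (hj : j ∈ B) :
      RCLike.re (e.coord j x * a j) = ‖e.coord j x‖ * RCLike.re (u j) := by
    conv_lhs => rw [(hxB j hj).2.2, mul_assoc, RCLike.re_ofReal_mul]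
  have hx1 (j : ι) : ‖e.coord j x‖ ≤ 1 := (e.norm_coord_le j x).trans hx
  have hφB : RCLike.re (φ x) ≤
      ∑ j ∈ B, RCLike.re (e.coord j x * a j) + (1 - c ^ 2) * (1 - r) := by
    have h1 := e.norm_sub_sum_le φ B (by linarith) x hxN
    have h2 : (1 - c ^ 2) * (‖φ‖ - r) ≤ (1 - c ^ 2) * (1 - r) :=
      mul_le_mul_of_nonneg_left (by linarith) (by linarith)
    have h3 := RCLike.re_le_norm (φ x - ∑ j ∈ B, e.coord j x * a j)
    rw [map_sub, map_sum] at h3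
    linarith
  have hr2 : 1 - r < c ^ 2 := by
    have h1 : ∑ j ∈ B, RCLike.re (e.coord j x * a j) ≤ r := by
      refine Finset.sum_le_sum fun j hj => (RCLike.re_le_norm _).trans ?_
      rw [norm_mul]
      exact mul_le_of_le_one_left (norm_nonneg _) (hx1 j)
    have h2 : c ^ 2 * (1 - r) < c ^ 2 * c ^ 2 := by nlinarith
    exact lt_of_mul_lt_mul_left h2 hc2'.le
  have hr0 : 0 < r := by linarith
  have hsum : ∑ j ∈ B, (‖u j‖ - RCLike.re (u j)) ≤ c ^ 4 + c ^ 2 := by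
    have h1 : ∑ j ∈ B, RCLike.re (e.coord j x * a j) ≤
        ∑ j ∈ B, (RCLike.re (u j) + c ^ 2 * ‖a j‖) := by
      refine Finset.sum_le_sum fun j hj => ?_
      rw [hre hj, ← hun hj]
      have := (hxB j hj).1
      nlinarith [hure j, hure' j, norm_nonneg (u j), hx1 j]
    rw [Finset.sum_add_distrib, ← Finset.mul_sum] at h1
    have h2 : ∑ j ∈ B, ‖u j‖ = r := Finset.sum_congr rfl fun j hj => hun hj
    rw [Finset.sum_sub_distrib, h2]
    nlinarith
  -- Correct the phases of the coordinates of `φ` in `B` and rescale them to total mass one.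
  set b : ι → 𝕜 := fun j => star (e.coord j y) * ((‖a j‖ / r : ℝ) : 𝕜) with hb
  have hsumr : ∑ j ∈ B, ‖a j‖ / r = 1 := by
    rw [← Finset.sum_div, div_self hr0.ne']
  refine ⟨∑ j ∈ B, b j • e.coord j, ?_, ?_, ?_⟩
  · refine (e.norm_sum_smul_coord_le B b).trans (le_of_eq ?_)
    rw [← hsumr]
    refine Finset.sum_congr rfl fun j hj => ?_
    rw [hb]
    simp only [norm_mul, norm_star, (hxB j hj).2.1, one_mul, RCLike.norm_ofReal]
    exact abs_of_nonneg (by positivity)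
  · have h1 : ∀ j ∈ B, b j * e.coord j y = ((‖a j‖ / r : ℝ) : 𝕜) := fun j hj => by
      rw [hb]
      simp only
      rw [mul_right_comm, star_mul_self_of_norm_eq_one (hxB j hj).2.1, one_mul]
    have h2 : (∑ j ∈ B, b j • e.coord j) y = ∑ j ∈ B, b j * e.coord j y := by simp
    rw [h2, Finset.sum_congr rfl h1, ← RCLike.ofReal_sum, hsumr, RCLike.ofReal_one]
  · refine (e.norm_sub_sum_coord_le φ B b).trans ?_
    have h1 : ∀ j ∈ B, ‖a j - b j‖ ≤
        (c * ‖a j‖ + (‖u j‖ - RCLike.re (u j)) / (2 * c)) + (‖a j‖ / r - ‖a j‖) := by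
      intro j hj
      have h2 : a j - b j = star (e.coord j y) * ((u j - (‖u j‖ : 𝕜)) -
          ((‖a j‖ / r - ‖a j‖ : ℝ) : 𝕜)) := by
        have h3 : a j = star (e.coord j y) * u j := by
          rw [hu]
          simp only
          rw [← mul_assoc, star_mul_self_of_norm_eq_one (hxB j hj).2.1, one_mul]
        have h4 : b j = star (e.coord j y) * ((‖a j‖ / r : ℝ) : 𝕜) := rfl
        rw [hun hj, RCLike.ofReal_sub, h4]
        nth_rewrite 1 [h3]
        ring
      rw [h2, norm_mul, norm_star, (hxB j hj).2.1, one_mul]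
      refine (norm_sub_le _ _).trans (add_le_add ?_ (le_of_eq ?_))
      · rw [← hun hj]
        exact norm_sub_norm_le _ hc
      · rw [RCLike.norm_ofReal]
        refine abs_of_nonneg (sub_nonneg.2 ?_)
        exact le_div_self (norm_nonneg _) hr0 hr1
    have h2 := Finset.sum_le_sum h1
    rw [Finset.sum_add_distrib, Finset.sum_add_distrib, Finset.sum_sub_distrib, hsumr,
      ← Finset.mul_sum, ← Finset.sum_div] at h2
    have h3 : (∑ j ∈ B, (‖u j‖ - RCLike.re (u j))) / (2 * c) ≤ (c ^ 4 + c ^ 2) / (2 * c) := by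
      gcongr
    have h4 : (c ^ 4 + c ^ 2) / (2 * c) = (c ^ 3 + c) / 2 := by
      field_simp
    have h5 : c ^ 3 ≤ c := by nlinarith
    change ‖φ‖ - r + ∑ j ∈ B, ‖a j - b j‖ ≤ 4 * c
    have h6 : c * r ≤ c := by nlinarith
    have h7 : c ^ 2 ≤ c := by nlinarith
    linarith

/-- Replacing finitely many coordinates of a compact operator by given functionals. -/
lemma exists_replace_rows {T : X →L[𝕜] X} (hT : IsCompactOperator T) (A : Finset ι)
    (s : ι → StrongDual 𝕜 X) :
    ∃ S : X →L[𝕜] X, IsCompactOperator S ∧ (∀ i ∈ A, ∀ z, e.coord i (S z) = s i z) ∧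
      ∀ i ∉ A, ∀ z, e.coord i (S z) = e.coord i (T z) := by
  set R : ι → X →L[𝕜] X := fun i => (s i - (e.coord i).comp T).smulRight (e.vec i) with hR
  have hRz (z : X) : (T + ∑ i ∈ A, R i) z =
      T z + ∑ i ∈ A, (s i z - e.coord i (T z)) • e.vec i := by
    simp [hR]
  refine ⟨T + ∑ i ∈ A, R i, ?_, fun i hi z => ?_, fun i hi z => ?_⟩
  · have h1 (i : ι) : IsCompactOperator (R i) := by
      have h2 : IsCompactOperator (s i - (e.coord i).comp T) :=
        isCompactOperator_of_locallyCompactSpace_dom _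
      exact h2.clm_comp (ContinuousLinearMap.toSpanSingleton 𝕜 (e.vec i))
    have h3 : ∑ i ∈ A, R i ∈ {S : X →L[𝕜] X | IsCompactOperator S} := by
      induction A using Finset.cons_induction with
      | empty => simpa using isCompactOperator_zero
      | cons i A hi ih =>
        rw [Finset.sum_cons]
        exact (h1 i).add (ih (by simp [hR]))
    exact hT.add h3
  · rw [hRz, map_add, e.coord_sum_smul_vec_of_mem _ hi]
    ring
  · rw [hRz, map_add, e.coord_sum_smul_vec_of_notMem _ hi, add_zero]

/-- In a state pair the functional is supported on the coordinates where the vector has absolute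
value one, and has the conjugate phases there. -/
lemma coord_mul_apply_vec {x : X} {φ : StrongDual 𝕜 X} (h : (x, φ) ∈ statePairs 𝕜 X) (i : ι) :
    e.coord i x * φ (e.vec i) = ‖φ (e.vec i)‖ := by
  obtain ⟨hx, hφ, hφx⟩ := h
  simp only at hx hφ hφx
  have h1 := e.norm_sub_sum_le φ {i} zero_le_one x fun j _ => (e.norm_coord_le j x).trans hx.le
  rw [Finset.sum_singleton, Finset.sum_singleton, hφx, hφ, one_mul] at h1
  have h2 := (RCLike.re_le_norm _).trans h1
  rw [map_sub, RCLike.one_re] at h2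
  have h3 : ‖e.coord i x * φ (e.vec i)‖ ≤ ‖φ (e.vec i)‖ := by
    rw [norm_mul]
    exact mul_le_of_le_one_left (norm_nonneg _) ((e.norm_coord_le i x).trans hx.le)
  have h4 := RCLike.re_le_norm (e.coord i x * φ (e.vec i))
  have h5 : ‖e.coord i x * φ (e.vec i)‖ = ‖φ (e.vec i)‖ := by linarith
  rw [← RCLike.re_eq_self_of_le (a := e.coord i x * φ (e.vec i)) (by linarith)]
  congr 1
  linarith

/-- If `φ` nearly attains its norm at `z`, then the coordinates at which the contribution to `φ z`
has nearly its largest possible real part (after the rotation `θ`) carry almost all of the mass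
of `φ`. -/
lemma exists_finset_mass {z : X} {φ : StrongDual 𝕜 X} {θ : 𝕜} {c : ℝ} (hc : 0 < c) (hc1 : c < 1)
    (hz : ‖z‖ ≤ 1) (hφ : ‖φ‖ = 1) (hθ : ‖θ‖ = 1) (h : 1 - c ^ 6 < RCLike.re (θ * φ z)) :
    ∃ A : Finset ι, 1 - c ^ 2 < ∑ i ∈ A, ‖φ (e.vec i)‖ ∧
      ∀ i ∈ A, (1 - c ^ 4) * ‖φ (e.vec i)‖ < RCLike.re (θ * (e.coord i z * φ (e.vec i))) := by
  classical
  have hc4 : c ^ 4 < 1 := pow_lt_one₀ hc.le hc1 (by norm_num)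
  have hfin := e.finite_le z (r := 1 - c ^ 4) (by linarith)
  set B := hfin.toFinset with hB
  have hN : ∀ j ∉ B, ‖e.coord j z‖ ≤ 1 - c ^ 4 := fun j hj => by
    simp only [hB, Set.Finite.mem_toFinset, Set.mem_ofPred_eq, not_le] at hj
    exact hj.le
  set p : ι → ℝ := fun i => RCLike.re (θ * (e.coord i z * φ (e.vec i))) with hp
  have hple (i : ι) : p i ≤ ‖φ (e.vec i)‖ := by
    refine (RCLike.re_le_norm _).trans ?_
    rw [norm_mul, hθ, one_mul, norm_mul]
    exact mul_le_of_le_one_left (norm_nonneg _) ((e.norm_coord_le i z).trans hz)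
  set P : ι → Prop := fun i => (1 - c ^ 4) * ‖φ (e.vec i)‖ < p i with hP
  refine ⟨B.filter P, ?_, fun i hi => (Finset.mem_filter.1 hi).2⟩
  have h1 := e.norm_sub_sum_le φ B (by linarith) z hN
  have h2 : RCLike.re (θ * φ z) ≤ ∑ i ∈ B, p i + (1 - c ^ 4) * (1 - ∑ i ∈ B, ‖φ (e.vec i)‖) := by
    have h3 := RCLike.re_le_norm (θ * (φ z - ∑ j ∈ B, e.coord j z * φ (e.vec j)))
    rw [norm_mul, hθ, one_mul, mul_sub, Finset.mul_sum, map_sub, map_sum] at h3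
    rw [hφ] at h1
    linarith
  have h4 := Finset.sum_filter_add_sum_filter_not B P p
  have h5 := Finset.sum_filter_add_sum_filter_not B P fun i => ‖φ (e.vec i)‖
  have h6 : ∑ i ∈ B.filter P, p i ≤ ∑ i ∈ B.filter P, ‖φ (e.vec i)‖ :=
    Finset.sum_le_sum fun i _ => hple i
  have h7 : ∑ i ∈ B.filter (fun i => ¬ P i), p i ≤
      (1 - c ^ 4) * ∑ i ∈ B.filter (fun i => ¬ P i), ‖φ (e.vec i)‖ := by
    rw [Finset.mul_sum]
    exact Finset.sum_le_sum fun i hi => not_lt.1 (Finset.mem_filter.1 hi).2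
  set W := ∑ i ∈ B.filter P, ‖φ (e.vec i)‖
  have h8 : c ^ 4 * (1 - W) < c ^ 4 * c ^ 2 := by
    rw [← h5] at h2
    nlinarith
  have := lt_of_mul_lt_mul_left h8 (by positivity)
  linarith

/-! ### The Bishop-Phelps-Bollobás property -/

/-- Every space with null coordinates has the property, with a function that does not depend on
the space. -/
theorem hasBPBpNuCompactWith (η : Set.Ioo (0 : ℝ) 1 → Set.Ioo (0 : ℝ) 1)
    (hη : ∀ ε, (η ε : ℝ) = ((ε : ℝ) / 8) ^ 6) : HasBPBpNuCompactWith 𝕜 X η := by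
  intro ε T x x' hT hxx' hν hη'
  obtain ⟨hε0, hε1⟩ := ε.2
  rw [hη] at hη'
  -- The row perturbation costs `4 * c`, the change of `x'` costs `2 * c ^ 2`, that of `x` `c ^ 2`.
  set c : ℝ := (ε : ℝ) / 8 with hc
  have hc0 : 0 < c := by positivity
  have hc1 : c < 1 := by linarith
  have hc2 : c ^ 2 < c := by nlinarith
  have hx : ‖x‖ = 1 := hxx'.1
  have hx' : ‖x'‖ = 1 := hxx'.2.1
  have hTn : ‖T‖ ≤ 1 := hν ▸ e.norm_le_numericalRadius T
  have hTz (z : X) : ‖T z‖ ≤ ‖z‖ := by simpa using T.le_of_opNorm_le hTn z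
  obtain ⟨θ, hθ, hθT⟩ := RCLike.exists_norm_eq_mul_self (x' (T x))
  obtain ⟨A, hAW, hA⟩ := e.exists_finset_mass hc0 hc1 ((hTz x).trans hx.le) hx' hθ
    (by rwa [← hθT, RCLike.ofReal_re])
  obtain ⟨B, y, hy1, hxy, hxN, hxB⟩ := e.exists_near_unimodular hx.le (d := c ^ 2)
    (by positivity) (by linarith)
  set W := ∑ i ∈ A, ‖x' (e.vec i)‖ with hW
  have hW0 : 0 < W := by linarith
  have hW1 : W ≤ 1 := hx' ▸ e.sum_norm_apply_vec_le x' A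
  have hphase := e.coord_mul_apply_vec hxx'
  have hne {i : ι} (hi : i ∈ A) : ‖x' (e.vec i)‖ ≠ 0 := fun h => by
    have := hA i hi
    simp [norm_eq_zero.1 h] at this
  have hx1 {i : ι} (hi : i ∈ A) : ‖e.coord i x‖ = 1 := by
    have := congrArg norm (hphase i)
    rw [norm_mul, RCLike.norm_ofReal, abs_norm] at this
    exact mul_right_cancel₀ (hne hi) (by rw [this, one_mul])
  have hyx {i : ι} (hi : i ∈ A) : e.coord i y = e.coord i x := by
    have hiB : i ∈ B := by
      by_contra h
      have := hxN i h
      rw [hx1 hi] at this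
      nlinarith
    have := (hxB i hiB).2.2
    rwa [hx1 hi, RCLike.ofReal_one, one_mul, eq_comm] at this
  -- After the rotation by `star σ`, each row of `T` indexed by `A` nearly attains its norm at `x`.
  have hrow (i : ι) (hi : i ∈ A) : ∃ s : StrongDual 𝕜 X, ‖s‖ ≤ 1 ∧
      s y = star θ * e.coord i x ∧ ‖(e.coord i).comp T - s‖ ≤ 4 * c := by
    have hσ : ‖star θ * e.coord i x‖ = 1 := by rw [norm_mul, norm_star, hθ, hx1 hi, one_mul]
    set σ := star θ * e.coord i x with hσdef
    have hσσ : σ * star σ = 1 := by rw [mul_comm, star_mul_self_of_norm_eq_one hσ]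
    have hφn : ‖star σ • (e.coord i).comp T‖ ≤ 1 := by
      rw [norm_smul, norm_star, hσ, one_mul]
      exact ContinuousLinearMap.opNorm_le_bound _ zero_le_one fun z => by
        simpa using (e.norm_coord_le i (T z)).trans (hTz z)
    have hφx : 1 - c ^ 4 < RCLike.re ((star σ • (e.coord i).comp T) x) := by
      have h1 : x' (e.vec i) = star (e.coord i x) * ‖x' (e.vec i)‖ := by
        rw [← hphase i, ← mul_assoc, star_mul_self_of_norm_eq_one (hx1 hi), one_mul]
      have h2 : θ * (e.coord i (T x) * x' (e.vec i)) =
          ‖x' (e.vec i)‖ * (star σ • (e.coord i).comp T) x := by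
        nth_rewrite 1 [h1]
        simp only [hσdef, star_mul, star_star, smul_apply, ContinuousLinearMap.comp_apply,
          smul_eq_mul]
        ring
      have h3 := hA i hi
      rw [h2, RCLike.re_ofReal_mul, mul_comm] at h3
      exact lt_of_mul_lt_mul_left h3 (norm_nonneg _)
    obtain ⟨ψ, hψ, hψy, hφψ⟩ := e.exists_near_functional hc0 hc1 hx.le hxN hxB hφn hφx
    refine ⟨σ • ψ, ?_, by simp [hψy], ?_⟩
    · rwa [norm_smul, hσ, one_mul]
    · have : (e.coord i).comp T - σ • ψ = σ • (star σ • (e.coord i).comp T - ψ) := by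
        rw [smul_sub, smul_smul, hσσ, one_smul]
      rwa [this, norm_smul, hσ, one_mul]
  choose! s hs hsy hsT using hrow
  obtain ⟨S, hS, hSA, hSN⟩ := e.exists_replace_rows hT A s
  have hSn : ‖S‖ ≤ 1 := by
    refine ContinuousLinearMap.opNorm_le_bound _ zero_le_one fun z => ?_
    rw [one_mul]
    refine e.norm_le (norm_nonneg z) fun i => ?_
    by_cases hi : i ∈ A
    · rw [hSA i hi]
      simpa using (s i).le_of_opNorm_le (hs i hi) z
    · rw [hSN i hi]
      exact (e.norm_coord_le i _).trans (hTz z)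
  have hTS : ‖T - S‖ ≤ 4 * c := by
    refine ContinuousLinearMap.opNorm_le_bound _ (by positivity) fun z => ?_
    refine e.norm_le (by positivity) fun i => ?_
    rw [sub_apply, map_sub]
    by_cases hi : i ∈ A
    · rw [hSA i hi]
      exact ContinuousLinearMap.le_of_opNorm_le _ (hsT i hi) z
    · rw [hSN i hi, sub_self, norm_zero]
      positivity
  set y' : StrongDual 𝕜 X := ∑ i ∈ A, ((W⁻¹ : ℝ) * x' (e.vec i)) • e.coord i with hy'
  have hy'z (z : X) : y' z = (W⁻¹ : ℝ) * ∑ i ∈ A, e.coord i z * x' (e.vec i) := by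
    rw [hy', Finset.mul_sum, sum_apply]
    refine Finset.sum_congr rfl fun i _ => ?_
    simp only [smul_apply, smul_eq_mul]
    ring
  have hWsum : ((W⁻¹ : ℝ) : 𝕜) * ∑ i ∈ A, e.coord i x * x' (e.vec i) = 1 := by
    rw [Finset.sum_congr rfl fun i _ => hphase i, ← RCLike.ofReal_sum, ← RCLike.ofReal_mul,
      inv_mul_cancel₀ hW0.ne', RCLike.ofReal_one]
  have hy'n : ‖y'‖ ≤ 1 := by
    refine (e.norm_sum_smul_coord_le A _).trans (le_of_eq ?_)
    simp only [norm_mul, RCLike.norm_ofReal, abs_inv, abs_of_pos hW0]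
    rw [← Finset.mul_sum, inv_mul_cancel₀ hW0.ne']
  have hy'y : y' y = 1 := by
    rw [hy'z, ← hWsum]
    congr 1
    exact Finset.sum_congr rfl fun i hi => by rw [hyx hi]
  have hyn : ‖y‖ = 1 := by
    refine le_antisymm hy1 ?_
    have := y'.le_opNorm y
    rw [hy'y, norm_one] at this
    nlinarith [norm_nonneg y]
  have hpair : (y, y') ∈ statePairs 𝕜 X := mem_statePairs hyn hy'n hy'y
  have hSy : ‖y' (S y)‖ = 1 := by
    have h1 : y' (S y) = star θ := by
      rw [hy'z, ← mul_one (star θ), ← hWsum, mul_left_comm]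
      congr 1
      rw [Finset.mul_sum]
      exact Finset.sum_congr rfl fun i hi => by rw [hSA i hi, hsy i hi, mul_assoc]
    rw [h1, norm_star, hθ]
  refine ⟨S, y, y', hS, hpair, le_antisymm ((numericalRadius_le_norm S).trans hSn) ?_, hSy,
    by linarith, by linarith, ?_⟩
  · exact hSy ▸ norm_apply_le_numericalRadius S hpair
  · refine (e.norm_sub_sum_coord_le x' A _).trans_lt ?_
    have h1 : ∀ i ∈ A, ‖x' (e.vec i) - (W⁻¹ : ℝ) * x' (e.vec i)‖ =
        (W⁻¹ - 1) * ‖x' (e.vec i)‖ := fun i _ => by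
      have h2 : x' (e.vec i) - (W⁻¹ : ℝ) * x' (e.vec i) =
          ((1 - W⁻¹ : ℝ) : 𝕜) * x' (e.vec i) := by
        rw [RCLike.ofReal_sub, RCLike.ofReal_one]
        ring
      have h3 : 1 ≤ W⁻¹ := (one_le_inv₀ hW0).2 hW1
      rw [h2, norm_mul, RCLike.norm_ofReal, abs_of_nonpos (by linarith)]
      ring
    rw [Finset.sum_congr rfl h1, ← Finset.mul_sum, ← hW, hx', sub_mul, inv_mul_cancel₀ hW0.ne']
    linarith

end NullCoordinates

/-! ### The coordinates of `c₀` and `ℓ_∞^n` -/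

/-- The coordinates of `c₀`. -/
noncomputable def nullCoordinatesZeroAtInfty (𝕜 : Type*) [RCLike 𝕜] :
    NullCoordinates 𝕜 C₀(ℕ, 𝕜) ℕ where
  vec i :=
    { toFun := Pi.single (M := fun _ => 𝕜) i 1
      continuous_toFun := continuous_of_discreteTopology
      zero_at_infty' := by
        rw [cocompact_eq_cofinite]
        refine tendsto_const_nhds.congr' ?_
        filter_upwards [(Set.finite_singleton i).compl_mem_cofinite] with j hj
        exact (Pi.single_eq_of_ne (M := fun _ => 𝕜) (by simpa using hj) _).symm }
  coord i := LinearMap.mkContinuous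
    { toFun := fun f => f i
      map_add' := fun _ _ => rfl
      map_smul' := fun _ _ => rfl } 1 (fun f => by
        rw [one_mul, ← ZeroAtInftyContinuousMap.norm_toBCF_eq_norm]
        exact f.toBCF.norm_coe_le_norm i)
  coord_vec_self i := Pi.single_eq_same (M := fun _ => 𝕜) i 1
  coord_vec_of_ne h := Pi.single_eq_of_ne (M := fun _ => 𝕜) h 1
  norm_coord_le i f := by
    rw [← ZeroAtInftyContinuousMap.norm_toBCF_eq_norm]
    exact f.toBCF.norm_coe_le_norm i
  norm_le {f r} hr h := by
    rw [← ZeroAtInftyContinuousMap.norm_toBCF_eq_norm]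
    exact (BoundedContinuousFunction.norm_le hr).2 h
  finite_le f r hr := by
    have h := f.zero_at_infty'
    rw [cocompact_eq_cofinite] at h
    have h2 : ∀ᶠ i in cofinite, ‖f i‖ < r := h.norm.eventually_lt_const (by simpa using hr)
    simpa [eventually_cofinite] using h2

/-- The coordinates of `ℓ_∞^n`. -/
noncomputable def nullCoordinatesPi (𝕜 : Type*) [RCLike 𝕜] (n : ℕ) :
    NullCoordinates 𝕜 (Fin n → 𝕜) (Fin n) where
  vec i := Pi.single i 1
  coord i := ContinuousLinearMap.proj i
  coord_vec_self i := by simp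
  coord_vec_of_ne h := by simp [h]
  norm_coord_le i x := norm_le_pi_norm x i
  norm_le hr h := (pi_norm_le_iff_of_nonneg hr).2 h
  finite_le _ _ _ := Set.toFinite _

end BPB

/-- Here `C₀(ℕ, 𝕜)` (with `ℕ` discrete) is `c₀`, and `Fin n → 𝕜`, with its sup norm, is `ℓ_∞^n`. -/
theorem corollary2p4 (𝕜 : Type*) [RCLike 𝕜] :
    ∃ η : Set.Ioo (0 : ℝ) 1 → Set.Ioo (0 : ℝ) 1,
      BPB.HasBPBpNuCompactWith 𝕜 C₀(ℕ, 𝕜) η ∧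
      ∀ n : ℕ, BPB.HasBPBpNuCompactWith 𝕜 (Fin n → 𝕜) η := by
  let η : Set.Ioo (0 : ℝ) 1 → Set.Ioo (0 : ℝ) 1 := fun ε => ⟨((ε : ℝ) / 8) ^ 6, by
    obtain ⟨h0, h1⟩ := ε.2
    exact ⟨by positivity, pow_lt_one₀ (by positivity) (by linarith) (by norm_num)⟩⟩
  exact ⟨η, (BPB.nullCoordinatesZeroAtInfty 𝕜).hasBPBpNuCompactWith η fun _ => rfl,
    fun n => (BPB.nullCoordinatesPi 𝕜 n).hasBPBpNuCompactWith η fun _ => rfl⟩
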